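/- Let $k>0$, $R>0$, $N\in\{0,1,2,\dots\}$, $B(0,R)=\{x\in\mathbb R^3:|x|<R\}$ and $S(0,k)=\{z\in\mathbb R^3:|z|=k\}$ with surface measure $dS$. For $n\ge 0$, $-n\le m\le n$ let $Y_{nm}$ be the spherical harmonics on the unit sphere, $$Y_{nm}(\sin\theta\cos\varphi,\sin\theta\sin\varphi,\cos\theta)=\sqrt{\tfrac{2n+1}{4\pi}\tfrac{(n-|m|)!}{(n+|m|)!}}\;P_n^{|m|}(\cos\theta)\,e^{im\varphi},\qquad P_n^{m}(t)=(1-t^2)^{m/2}\tfrac{d^m}{dt^m}P_n(t),$$ where $P_n$ is the Legendre polynomial; they are orthonormal in $L^2(S(0,1))$. Let $j_n$ be the spherical Bessel function of order $n$ and $u_{nm}(x)=j_n(k|x|)\,Y_{nm}(x/|x|)$, extended continuously to $x=0$. Inner products are conjugate linear in the first argument. Let $f:\mathbb R^3\to\mathbb C$ be an $L^\infty$ function that vanishes almost everywhere outside $B(0,R)$, and put $\hat f(\xi)=\int_{\mathbb R^3} f(x)e^{-ix\cdot\xi}\,dx$. Let $f_{R,N}$ be the orthogonal projection of $f$ in $L^2(B(0,R))$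 onto $S_{R,N}=\operatorname{span}\{u_{nm}|_{B(0,R)}: 0\le n\le N,\ -n\le m\le n\}$. Then $f_{R,N}$ is (the restriction to $B(0,R)$ of) the Herglotz wave function on $S(0,k)$ with density $$g_{R,N}(z)=\frac{1}{(4\pi k^2)^2}\sum_{n=0}^N\sum_{m=-n}^n\frac{\langle Y_{nm}(\cdot/k),\hat f\rangle_{L^2(S(0,k))}}{\langle u_{nm},u_{nm}\rangle_{L^2(B(0,R))}}\,Y_{nm}(z/k),$$ that is, $g_{R,N}\in L^2(S(0,k))$ and $$f_{R,N}(x)=\int_{S(0,k)}g_{R,N}(z)\,e^{ix\cdot z}\,dS(z)\quad\text{for almost every }x\in B(0,R).$$ Moreover, for every $x\in\mathbb R^3$, $$\sum_{n=0}^N\sum_{m=-n}^n\frac{\langle u_{nm},f\rangle_{L^2(B(0,R))}}{\langle u_{nm},u_{nm}\rangle_{L^2(B(0,R))}}\,u_{nm}(x)=\int_{S(0,k)}g_{R,N}(z)\,e^{ix\cdot z}\,dS(z).$$ -/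

import Mathlib

open MeasureTheory

open scoped Nat

noncomputable section

namespace HerglotzBall

/-- Three dimensional Euclidean space. -/
abbrev E3 : Type := EuclideanSpace ℝ (Fin 3)

/-- Surface measure `dS` of the sphere `S(0,k)` in `ℝ³`, as a measure on `ℝ³`: the image of the
surface measure of the unit sphere under `ω ↦ k ω`, multiplied by `k ^ 2`. -/
def surf (k : ℝ) : Measure E3 :=
  ENNReal.ofReal (k ^ 2) •
    (volume : Measure E3).toSphere.map (fun ω : Metric.sphere (0 : E3) 1 => k • (ω : E3))

/-- The Herglotz wave function on `S(0,k)` with density `g`. -/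
def herglotz (k : ℝ) (g : E3 → ℂ) (x : E3) : ℂ :=
  ∫ z, g z * Complex.exp (Complex.I * (inner ℝ x z : ℝ)) ∂(surf k)

/-- The Fourier transform, normalized as `∫ f(x) exp(-i x · ξ) dx`. -/
def fhat (f : E3 → ℂ) (ξ : E3) : ℂ :=
  ∫ x, f x * Complex.exp (-(Complex.I * (inner ℝ x ξ : ℝ)))

/-- The spherical Bessel function `j_n`, by its (everywhere convergent) power series
`∑ (-1)^p t^(n+2p) / (2^p p! 1·3·5⋯(2n+2p+1))`. -/
def sphericalBessel (n : ℕ) (t : ℝ) : ℝ :=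
  ∑' p : ℕ, (-1) ^ p * t ^ (n + 2 * p) / (2 ^ p * (p ! : ℝ) * ((2 * n + 2 * p + 1)‼ : ℝ))

/-- The Legendre polynomial `P_n`, by the Rodrigues formula. -/
def legendreP (n : ℕ) : Polynomial ℝ :=
  Polynomial.C (1 / (2 ^ n * (n ! : ℝ))) *
    (Polynomial.derivative^[n] ((Polynomial.X ^ 2 - 1) ^ n))

/-- The normalized spherical harmonic `Y_{nm}`, `|m| ≤ n`. On the unit sphere, where
`x = (sin θ cos α, sin θ sin α, cos θ)`, it is
`√((2n+1)/(4π) · (n-|m|)!/(n+|m|)!) P_n^{|m|}(cos θ) exp(i m α)`, with the associated Legendre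
function `P_n^m(t) = (1-t²)^{m/2} (d/dt)^m P_n(t)`; here `(sin θ)^{|m|} exp(i m α)` is written
as `(x₁ ± i x₂)^{|m|}`. See `sphericalHarmonic_angles`. -/
def sphericalHarmonic (n : ℕ) (m : ℤ) (x : E3) : ℂ :=
  (Real.sqrt ((2 * n + 1) / (4 * Real.pi) *
      (((n - m.natAbs)! : ℝ) / ((n + m.natAbs)! : ℝ))) : ℝ) *
    ((Polynomial.derivative^[m.natAbs] (legendreP n)).eval (x 2) : ℝ) *
    (if 0 ≤ m then (x 0 : ℂ) + Complex.I * (x 1 : ℂ)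
      else (x 0 : ℂ) - Complex.I * (x 1 : ℂ)) ^ m.natAbs

theorem sphericalHarmonic_angles (n : ℕ) (m : ℤ) (θ α : ℝ) :
    sphericalHarmonic n m
        (!₂[Real.sin θ * Real.cos α, Real.sin θ * Real.sin α, Real.cos θ] : E3) =
      (Real.sqrt ((2 * n + 1) / (4 * Real.pi) *
        (((n - m.natAbs)! : ℝ) / ((n + m.natAbs)! : ℝ))) : ℝ) *
      ((Real.sin θ ^ m.natAbs *
        (Polynomial.derivative^[m.natAbs] (legendreP n)).eval (Real.cos θ) : ℝ) : ℂ) *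
      Complex.exp (Complex.I * m * α) := by
  have key : (if 0 ≤ m then ((Real.sin θ * Real.cos α : ℝ) : ℂ)
        + Complex.I * ((Real.sin θ * Real.sin α : ℝ) : ℂ)
      else ((Real.sin θ * Real.cos α : ℝ) : ℂ)
        - Complex.I * ((Real.sin θ * Real.sin α : ℝ) : ℂ)) ^ m.natAbs
      = ((Real.sin θ : ℝ) : ℂ) ^ m.natAbs * Complex.exp (Complex.I * m * α) := by
    split_ifs with h
    · have hm : ((m.natAbs : ℕ) : ℂ) = (m : ℂ) := by
        have : ((m.natAbs : ℕ) : ℤ) = m := Int.natAbs_of_nonneg h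
        rw [← Int.cast_natCast, this]
      have : Complex.exp (Complex.I * m * α) = (Complex.exp (α * Complex.I)) ^ m.natAbs := by
        rw [← Complex.exp_nat_mul, hm]; ring_nf
      rw [this, ← mul_pow, Complex.exp_mul_I]
      push_cast
      ring
    · have hm : ((m.natAbs : ℕ) : ℂ) = -(m : ℂ) := by
        have : ((m.natAbs : ℕ) : ℤ) = -m := Int.ofNat_natAbs_of_nonpos (by omega)
        rw [← Int.cast_natCast, this, Int.cast_neg]
      have : Complex.exp (Complex.I * m * α)
          = (Complex.exp ((-α : ℂ) * Complex.I)) ^ m.natAbs := by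
        rw [← Complex.exp_nat_mul, hm]; ring_nf
      rw [this, ← mul_pow, Complex.exp_mul_I, Complex.cos_neg, Complex.sin_neg]
      push_cast
      ring
  unfold sphericalHarmonic
  have h0 : (!₂[Real.sin θ * Real.cos α, Real.sin θ * Real.sin α, Real.cos θ] : E3) 0
      = Real.sin θ * Real.cos α := rfl
  have h1 : (!₂[Real.sin θ * Real.cos α, Real.sin θ * Real.sin α, Real.cos θ] : E3) 1
      = Real.sin θ * Real.sin α := rfl
  have h2 : (!₂[Real.sin θ * Real.cos α, Real.sin θ * Real.sin α, Real.cos θ] : E3) 2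
      = Real.cos θ := rfl
  rw [h0, h1, h2, key]
  push_cast
  ring

/-- The spherical wave function `u_{nm}(x) = j_n(k|x|) Y_{nm}(x/|x|)`. -/
def sphericalWave (k : ℝ) (n : ℕ) (m : ℤ) (x : E3) : ℂ :=
  (sphericalBessel n (k * ‖x‖) : ℂ) * sphericalHarmonic n m (‖x‖⁻¹ • x)

theorem continuous_sphericalHarmonic (n : ℕ) (m : ℤ) : Continuous (sphericalHarmonic n m) := by
  unfold sphericalHarmonic
  have h : Continuous fun x : E3 =>
      (if 0 ≤ m then (x 0 : ℂ) + Complex.I * (x 1 : ℂ)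
        else (x 0 : ℂ) - Complex.I * (x 1 : ℂ)) := by
    split_ifs <;> fun_prop
  have h' : Continuous fun x : E3 =>
      ((Polynomial.derivative^[m.natAbs] (legendreP n)).eval (x 2) : ℝ) :=
    (Polynomial.continuous _).comp (by fun_prop)
  exact (continuous_const.mul (Complex.continuous_ofReal.comp h')).mul (h.pow _)

theorem sphericalBessel_term_le (n p : ℕ) {t T : ℝ} (ht : |t| ≤ T) :
    ‖(-1) ^ p * t ^ (n + 2 * p) / (2 ^ p * (p ! : ℝ) * ((2 * n + 2 * p + 1)‼ : ℝ))‖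
      ≤ T ^ n * ((T ^ 2) ^ p / (p ! : ℝ)) := by
  have hT : 0 ≤ T := (abs_nonneg t).trans ht
  have hp : (0 : ℝ) < (p ! : ℝ) := by exact_mod_cast Nat.factorial_pos p
  have hd : (1 : ℝ) ≤ ((2 * n + 2 * p + 1)‼ : ℝ) := by
    exact_mod_cast Nat.doubleFactorial_pos _
  have h2 : (1 : ℝ) ≤ 2 ^ p := one_le_pow₀ (by norm_num)
  rw [norm_div, norm_mul, norm_pow, norm_neg, norm_one, one_pow, one_mul, norm_pow,
    Real.norm_eq_abs, Real.norm_of_nonneg (by positivity), ← mul_div_assoc, ← pow_mul, ← pow_add]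
  gcongr
  nlinarith [mul_le_mul h2 hd zero_le_one (by positivity)]

theorem continuous_sphericalBessel (n : ℕ) : Continuous (sphericalBessel n) := by
  rw [← continuousOn_univ]
  intro t _
  have hc : ContinuousOn (sphericalBessel n) (Metric.closedBall 0 (|t| + 1)) := by
    refine continuousOn_tsum (u := fun p => (|t| + 1) ^ n * (((|t| + 1) ^ 2) ^ p / (p ! : ℝ)))
      (fun p => by fun_prop) ((Real.summable_pow_div_factorial _).mul_left _) ?_
    intro p s hs
    exact sphericalBessel_term_le n p (by simpa using hs)
  refine (hc.continuousAt (Metric.closedBall_mem_nhds_of_mem ?_)).continuousWithinAt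
  simp

/-- The spherical wave functions are square integrable on balls. -/
theorem memLp_sphericalWave (k R : ℝ) (n : ℕ) (m : ℤ) :
    MemLp (sphericalWave k n m) 2 (volume.restrict (Metric.ball (0 : E3) R)) := by
  have hfin : IsFiniteMeasure (volume.restrict (Metric.ball (0 : E3) R)) :=
    ⟨by rw [Measure.restrict_apply_univ]; exact measure_ball_lt_top⟩
  have hmeas : Measurable (sphericalWave k n m) := by
    unfold sphericalWave
    have h1 := (continuous_sphericalBessel n).measurable
    have h2 := (continuous_sphericalHarmonic n m).measurable
    exact (Complex.measurable_ofReal.comp (h1.comp (by fun_prop))).mul (h2.comp (by fun_prop))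
  obtain ⟨A, hA⟩ := (isCompact_closedBall (0 : ℝ) (|k| * R)).exists_bound_of_continuousOn
    (continuous_sphericalBessel n).continuousOn
  obtain ⟨B, hB⟩ := (isCompact_closedBall (0 : E3) 1).exists_bound_of_continuousOn
    (continuous_sphericalHarmonic n m).continuousOn
  refine MemLp.of_bound hmeas.aestronglyMeasurable (A * B) ?_
  filter_upwards [ae_restrict_mem Metric.isOpen_ball.measurableSet] with x hx
  have hx' : ‖x‖ ≤ R := by simpa using (Metric.ball_subset_closedBall hx)
  have ha : ‖sphericalBessel n (k * ‖x‖)‖ ≤ A := by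
    apply hA
    simp only [mem_closedBall_zero_iff, norm_mul, Real.norm_eq_abs, abs_norm]
    gcongr
  have hb : ‖sphericalHarmonic n m (‖x‖⁻¹ • x)‖ ≤ B := by
    apply hB
    rw [mem_closedBall_zero_iff, norm_smul, norm_inv, norm_norm]
    exact inv_mul_le_one
  unfold sphericalWave
  rw [norm_mul, Complex.norm_real]
  exact mul_le_mul ha hb (norm_nonneg _) ((norm_nonneg _).trans ha)

/-- A bounded function is square integrable on balls. -/
theorem memLp_two_ball {f : E3 → ℂ} (hf : MemLp f ⊤ volume) (R : ℝ) :
    MemLp f 2 (volume.restrict (Metric.ball (0 : E3) R)) := by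
  have hfin : IsFiniteMeasure (volume.restrict (Metric.ball (0 : E3) R)) :=
    ⟨by rw [Measure.restrict_apply_univ]; exact measure_ball_lt_top⟩
  exact (hf.restrict _).mono_exponent le_top

/-- The Hilbert space `L²(B(0,R))` of complex valued functions. -/
abbrev L2Ball (R : ℝ) : Type := Lp ℂ 2 (volume.restrict (Metric.ball (0 : E3) R))

/-- The restriction `u_{nm}|_{B(0,R)}` as an element of `L²(B(0,R))`. -/
def waveL2 (k R : ℝ) (n : ℕ) (m : ℤ) : L2Ball R :=
  (memLp_sphericalWave k R n m).toLp (sphericalWave k n m)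

/-- The restriction of `f` to `B(0,R)` as an element of `L²(B(0,R))`. -/
def restrictL2 (R : ℝ) (f : E3 → ℂ) (hf : MemLp f ⊤ volume) : L2Ball R :=
  (memLp_two_ball hf R).toLp f

/-- The space `S_{R,N}` spanned by the `u_{nm}|_{B(0,R)}` with `0 ≤ n ≤ N`, `-n ≤ m ≤ n`. -/
def waveSpace (k R : ℝ) (N : ℕ) : Submodule ℂ (L2Ball R) :=
  Submodule.span ℂ
    (⋃ n ∈ Finset.range (N + 1), ⋃ m ∈ Finset.Icc (-(n : ℤ)) n, {waveL2 k R n m})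

instance (k R : ℝ) (N : ℕ) : FiniteDimensional ℂ (waveSpace k R N) :=
  FiniteDimensional.span_of_finite ℂ
    ((Finset.range (N + 1)).finite_toSet.biUnion fun n _ =>
      (Finset.Icc (-(n : ℤ)) n).finite_toSet.biUnion fun _ _ => Set.finite_singleton _)

/-- The best approximation `f_{R,N}`: the orthogonal projection of `f` onto `S_{R,N}` in
`L²(B(0,R))`. -/
def bestApprox (k R : ℝ) (N : ℕ) (f : E3 → ℂ) (hf : MemLp f ⊤ volume) : L2Ball R :=
  (waveSpace k R N).starProjection (restrictL2 R f hf)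

/-- The coefficient `⟨Y_{nm}(·/k), f̂⟩` in `L²(S(0,k))`, the inner product being conjugate linear
in its first argument. -/
def sphereCoeff (k : ℝ) (n : ℕ) (m : ℤ) (f : E3 → ℂ) : ℂ :=
  ∫ z, (starRingEnd ℂ) (sphericalHarmonic n m (k⁻¹ • z)) * fhat f z ∂(surf k)

/-- The density
`g_{R,N}(z) = (4πk²)⁻² ∑ ⟨Y_{nm}(·/k), f̂⟩ / ⟨u_{nm}, u_{nm}⟩ Y_{nm}(z/k)`. -/
def density (k R : ℝ) (N : ℕ) (f : E3 → ℂ) (z : E3) : ℂ :=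
  1 / (4 * (Real.pi : ℂ) * (k : ℂ) ^ 2) ^ 2 *
    ∑ n ∈ Finset.range (N + 1), ∑ m ∈ Finset.Icc (-(n : ℤ)) n,
      sphereCoeff k n m f / inner ℂ (waveL2 k R n m) (waveL2 k R n m) *
        sphericalHarmonic n m (k⁻¹ • z)

end HerglotzBall

end

/-! The core is the Funk–Hecke formula (`funkHecke`): integrating `Y_{nm}` against a plane wave over
the sphere gives `4π i^n` times a spherical wave. Scaled to `S(0,k)`, it says that the Herglotz wave
with density `Y_{nm}(·/k)` is `4πk² i^n u_{nm}` (`integral_surf_sphericalHarmonic`). Its conjugate,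
with Fubini, turns `⟨Y_{nm}(·/k), f̂⟩` into `4πk² conj(i^n) ⟨u_{nm}, f⟩` (`sphereCoeff_eq`). The
phases cancel and the two constants are absorbed by `(4πk²)⁻²`, so the Herglotz wave of `g_{R,N}` is
the expansion of `f` in the `u_{nm}` (`herglotz_density`). Since the `u_{nm}` are pairwise
orthogonal on the ball, this expansion is the projection (`bestApprox_eq_sum`). Their norms are
never computed.

Funk–Hecke is reduced to powers `(a·x)^n` of isotropic linear forms, `a·a = 0`, which span the
harmonics on the sphere (`sphericalHarmonic_eq_sum`). The Gaussian integral yields the moments of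
`(c·ω)^L` for complex `c`; polarizing with `c = s a + b` gives the mixed moments
(`sphere_mixed_moment`). Expanding the plane wave then reproduces the Bessel series term by term.
The same moments show that different degrees are orthogonal; different orders `m` are separated by
rotations about the third axis. -/

namespace HerglotzBall

/-! ### Complex linear forms and polar coordinates -/

/-- The complex bilinear pairing of `c ∈ ℂ³` with a real vector. -/
noncomputable def cdot (c : Fin 3 → ℂ) (x : E3) : ℂ := ∑ i, c i * (x i : ℂ)

/-- The surface measure of the unit sphere, as a measure on the sphere. -/
noncomputable abbrev sphereMeasure : Measure (Metric.sphere (0 : E3) 1) :=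
  (volume : Measure E3).toSphere

theorem continuous_cdot (c : Fin 3 → ℂ) : Continuous (cdot c) := by
  unfold cdot
  fun_prop

theorem cdot_smul (c : Fin 3 → ℂ) (r : ℝ) (x : E3) : cdot c (r • x) = r * cdot c x := by
  simp only [cdot, PiLp.smul_apply, smul_eq_mul, Complex.ofReal_mul, Finset.mul_sum]
  exact Finset.sum_congr rfl fun i _ => by ring

theorem cdot_eq_norm_mul (c : Fin 3 → ℂ) (x : E3) : cdot c x = ‖x‖ * cdot c (‖x‖⁻¹ • x) := by
  rw [← cdot_smul]
  rcases eq_or_ne x 0 with rfl | h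
  · simp
  · rw [smul_inv_smul₀ (norm_ne_zero_iff.2 h)]

theorem cdot_smul_left (c : Fin 3 → ℂ) (s : ℂ) (x : E3) : cdot (s • c) x = s * cdot c x := by
  simp only [cdot, Pi.smul_apply, smul_eq_mul, Finset.mul_sum]
  exact Finset.sum_congr rfl fun i _ => by ring

theorem cdot_add_left (c d : Fin 3 → ℂ) (x : E3) : cdot (c + d) x = cdot c x + cdot d x := by
  simp only [cdot, Pi.add_apply, add_mul, Finset.sum_add_distrib]

theorem norm_cdot_le (c : Fin 3 → ℂ) (x : E3) : ‖cdot c x‖ ≤ (∑ i, ‖c i‖) * ‖x‖ := by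
  unfold cdot
  refine (norm_sum_le _ _).trans ?_
  rw [Finset.sum_mul]
  refine Finset.sum_le_sum fun i _ => ?_
  rw [norm_mul, Complex.norm_real]
  gcongr
  exact PiLp.norm_apply_le x i

/-- Polar coordinates for a function that is a product of a radial and an angular factor. -/
theorem integral_radial_mul_angular (ρ : ℝ → ℂ) (G : E3 → ℂ) :
    ∫ x : E3, ρ ‖x‖ * G (‖x‖⁻¹ • x) =
      (∫ r in Set.Ioi (0 : ℝ), ((r ^ 2 : ℝ) : ℂ) * ρ r) * ∫ ω, G ω ∂sphereMeasure := by
  have h1 : ∫ x : E3, ρ ‖x‖ * G (‖x‖⁻¹ • x) =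
      ∫ x : ({(0 : E3)}ᶜ : Set E3), ρ ‖(x : E3)‖ * G (‖(x : E3)‖⁻¹ • (x : E3))
        ∂(Measure.comap Subtype.val volume) := by
    rw [integral_subtype_comap (measurableSet_singleton _).compl
      (fun x : E3 => ρ ‖x‖ * G (‖x‖⁻¹ • x)), restrict_compl_singleton]
  have h2 := (Measure.measurePreserving_homeomorphUnitSphereProd (volume : Measure E3)).integral_comp
    (Homeomorph.measurableEmbedding _)
    (fun p : Metric.sphere (0 : E3) 1 × Set.Ioi (0 : ℝ) => G p.1 * ρ p.2)
  have h3 : ∫ r : Set.Ioi (0 : ℝ), ρ r ∂(Measure.volumeIoiPow 2) =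
      ∫ r in Set.Ioi (0 : ℝ), ((r ^ 2 : ℝ) : ℂ) * ρ r := by
    rw [Measure.volumeIoiPow, ← integral_subtype_comap measurableSet_Ioi
      (fun r : ℝ => ((r ^ 2 : ℝ) : ℂ) * ρ r)]
    have : (fun r : Set.Ioi (0 : ℝ) => ENNReal.ofReal ((r : ℝ) ^ 2)) =
        fun r : Set.Ioi (0 : ℝ) => ((Real.toNNReal ((r : ℝ) ^ 2) : NNReal) : ENNReal) := rfl
    rw [this, integral_withDensity_eq_integral_smul (by fun_prop)]
    refine integral_congr_ae (Filter.Eventually.of_forall fun r => ?_)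
    simp only [NNReal.smul_def, Real.coe_toNNReal _ (sq_nonneg (r : ℝ)), Complex.real_smul]
  rw [h1, mul_comm, ← h3]
  -- The dimension minus one is the exponent of the radial density `r ^ 2`.
  have hd : Module.finrank ℝ E3 - 1 = 2 := by simp
  rw [hd] at h2
  rw [integral_prod_mul (fun ω : Metric.sphere (0 : E3) 1 => G ω)
    (fun r : Set.Ioi (0 : ℝ) => ρ r)] at h2
  rw [← h2]
  refine integral_congr_ae (Filter.Eventually.of_forall fun x => ?_)
  simp [homeomorphUnitSphereProd, mul_comm]

/-! ### Gaussian moments of complex linear forms -/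

theorem integral_cexp_cdot_gaussian (c : Fin 3 → ℂ) :
    ∫ x : E3, Complex.exp (cdot c x - (‖x‖ : ℂ) ^ 2) =
      ((Real.pi : ℂ) ^ (1 / 2 : ℂ)) ^ 3 * Complex.exp ((∑ i, c i ^ 2) / 4) := by
  have h := GaussianFourier.integral_cexp_neg_sum_mul_add (ι := Fin 3) (b := fun _ => 1)
    (by simp) c
  have h2 := (PiLp.volume_preserving_ofLp (Fin 3)).integral_comp
    (MeasurableEquiv.toLp 2 (Fin 3 → ℝ)).symm.measurableEmbedding
    (fun v : Fin 3 → ℝ => Complex.exp (-∑ i, (1 : ℂ) * (v i : ℂ) ^ 2 + ∑ i, c i * (v i : ℂ)))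
  rw [h] at h2
  rw [Finset.prod_mul_distrib, ← Complex.exp_sum] at h2
  simp only [Finset.prod_const, Finset.card_univ, Fintype.card_fin, div_one, mul_one,
    ← Finset.sum_div] at h2
  rw [← h2]
  refine integral_congr_ae (Filter.Eventually.of_forall fun x => ?_)
  simp only [cdot]
  congr 1
  have : (‖x‖ : ℂ) ^ 2 = ∑ i, (x i : ℂ) ^ 2 := by
    rw [← Complex.ofReal_pow, EuclideanSpace.norm_sq_eq]
    push_cast
    exact Finset.sum_congr rfl fun i _ => by rw [← Complex.ofReal_pow, ← Complex.ofReal_pow,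
      Real.norm_eq_abs, sq_abs]
  rw [this]
  simp only [one_mul]
  ring

theorem integrable_exp_mul_norm_sub_sq (C : ℝ) :
    Integrable (fun x : E3 => Real.exp (C * ‖x‖ - ‖x‖ ^ 2)) := by
  have h := (GaussianFourier.integrable_cexp_neg_mul_sq_norm_add (V := E3) (b := 1 / 2)
    (by norm_num) 0 0).norm.const_mul (Real.exp (C ^ 2 / 2))
  refine h.mono' (by fun_prop) (Filter.Eventually.of_forall fun x => ?_)
  rw [Real.norm_of_nonneg (Real.exp_pos _).le, Complex.norm_exp, ← Real.exp_add]
  gcongr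
  have : (-(1 / 2 : ℂ) * (‖x‖ : ℂ) ^ 2 + 0 * (inner ℝ (0 : E3) x : ℝ)).re = -(1 / 2) * ‖x‖ ^ 2 := by
    rw [zero_mul, add_zero, show (-(1 / 2 : ℂ) * (‖x‖ : ℂ) ^ 2) =
      ((-(1 / 2) * ‖x‖ ^ 2 : ℝ) : ℂ) by push_cast; ring, Complex.ofReal_re]
  rw [this]
  -- With `r = ‖x‖`, the bound `C r - r² ≤ C²/2 - r²/2` is `(C - r)² ≥ 0`.
  nlinarith [sq_nonneg (C - ‖x‖)]

/-- The Gaussian moment generating function as a power series. -/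
theorem hasSum_gaussian_moments (c : Fin 3 → ℂ) (s : ℂ) :
    HasSum (fun L : ℕ => s ^ L *
        ((∫ x : E3, cdot c x ^ L * Complex.exp (-(‖x‖ : ℂ) ^ 2)) / (L ! : ℂ)))
      (((Real.pi : ℂ) ^ (1 / 2 : ℂ)) ^ 3 * Complex.exp (s ^ 2 * (∑ i, c i ^ 2) / 4)) := by
  have h := integral_cexp_cdot_gaussian (s • c)
  have hs : ∑ i, (s • c) i ^ 2 = s ^ 2 * ∑ i, c i ^ 2 := by
    simp only [Pi.smul_apply, smul_eq_mul, mul_pow, Finset.mul_sum]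
  rw [hs] at h
  rw [← h]
  have hE : ∀ z : ℂ, HasSum (fun L : ℕ => z ^ L / (L ! : ℂ)) (Complex.exp z) := fun z => by
    rw [Complex.exp_eq_exp_ℂ]
    exact NormedSpace.expSeries_div_hasSum_exp z
  have hE' : ∀ z : ℝ, HasSum (fun L : ℕ => z ^ L / (L ! : ℝ)) (Real.exp z) := fun z => by
    rw [Real.exp_eq_exp_ℝ]
    exact NormedSpace.expSeries_div_hasSum_exp z
  have hn : ∀ x : E3, ‖Complex.exp (-(‖x‖ : ℂ) ^ 2)‖ = Real.exp (-‖x‖ ^ 2) := fun x => by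
    rw [Complex.norm_exp, ← Complex.ofReal_pow, ← Complex.ofReal_neg, Complex.ofReal_re]
  have hc := continuous_cdot c
  have hc' := continuous_cdot (s • c)
  have key := hasSum_integral_of_dominated_convergence
    (F := fun (L : ℕ) (x : E3) => cdot (s • c) x ^ L / (L ! : ℂ) * Complex.exp (-(‖x‖ : ℂ) ^ 2))
    (f := fun x : E3 => Complex.exp (cdot (s • c) x - (‖x‖ : ℂ) ^ 2))
    (μ := (volume : Measure E3))
    (fun (L : ℕ) (x : E3) => ‖cdot (s • c) x‖ ^ L / (L ! : ℝ) * Real.exp (-‖x‖ ^ 2))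
    (fun L => by
      have : Continuous fun x : E3 =>
        cdot (s • c) x ^ L / (L ! : ℂ) * Complex.exp (-(‖x‖ : ℂ) ^ 2) := by fun_prop
      exact this.aestronglyMeasurable)
    (fun L => Filter.Eventually.of_forall fun x => by
      rw [norm_mul, norm_div, norm_pow, hn, Complex.norm_natCast])
    (Filter.Eventually.of_forall fun x => ((hE' _).mul_right _).summable)
    (by
      -- The majorants sum to `exp(|s c·x| - ‖x‖²)`, which grows at most like `exp(C‖x‖ - ‖x‖²)`.
      simp only [fun x => ((hE' ‖cdot (s • c) x‖).mul_right (Real.exp (-‖x‖ ^ 2))).tsum_eq]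
      refine (integrable_exp_mul_norm_sub_sq (∑ i, ‖(s • c) i‖)).mono' (by fun_prop)
        (Filter.Eventually.of_forall fun x => ?_)
      rw [Real.norm_of_nonneg (by positivity), ← Real.exp_add, ← sub_eq_add_neg]
      gcongr
      exact norm_cdot_le _ _)
    (Filter.Eventually.of_forall fun x => by
      simpa only [sub_eq_add_neg, Complex.exp_add] using
        (hE (cdot (s • c) x)).mul_right (Complex.exp (-(‖x‖ : ℂ) ^ 2)))
  refine key.congr_fun (fun L => ?_)
  rw [← integral_div, ← integral_const_mul]
  refine integral_congr_ae (Filter.Eventually.of_forall fun x => ?_)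
  simp only [cdot_smul_left, mul_pow]
  ring

/-- Uniqueness of Taylor coefficients at `0`; it allows moments to be read off a generating
function. -/
theorem eq_of_hasSum_pow_mul {a b : ℕ → ℂ} {F : ℂ → ℂ}
    (ha : ∀ s, HasSum (fun n => s ^ n * a n) (F s)) (hb : ∀ s, HasSum (fun n => s ^ n * b n) (F s)) :
    a = b := by
  have h : ∀ a : ℕ → ℂ, (∀ s, HasSum (fun n => s ^ n * a n) (F s)) →
      HasFPowerSeriesAt F (FormalMultilinearSeries.ofScalars ℂ a) 0 := fun a ha => by
    rw [hasFPowerSeriesAt_iff]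
    refine Filter.Eventually.of_forall fun z => ?_
    simpa [FormalMultilinearSeries.coeff_ofScalars] using ha z
  have := (h a ha).eq_formalMultilinearSeries (h b hb)
  funext n
  rw [← FormalMultilinearSeries.coeff_ofScalars (𝕜 := ℂ) (p := a), this,
    FormalMultilinearSeries.coeff_ofScalars]

theorem gaussian_moments (c : Fin 3 → ℂ) (L : ℕ) :
    (∫ x : E3, cdot c x ^ L * Complex.exp (-(‖x‖ : ℂ) ^ 2)) / (L ! : ℂ) =
      if Even L then ((Real.pi : ℂ) ^ (1 / 2 : ℂ)) ^ 3 * (((∑ i, c i ^ 2) / 4) ^ (L / 2) /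
        ((L / 2)! : ℂ)) else 0 := by
  refine congrFun (eq_of_hasSum_pow_mul (hasSum_gaussian_moments c)
    (b := fun L => if Even L then ((Real.pi : ℂ) ^ (1 / 2 : ℂ)) ^ 3 *
      (((∑ i, c i ^ 2) / 4) ^ (L / 2) / ((L / 2)! : ℂ)) else 0) fun s => ?_) L
  have hE : HasSum (fun q : ℕ => (s ^ 2 * (∑ i, c i ^ 2) / 4) ^ q / (q ! : ℂ))
      (Complex.exp (s ^ 2 * (∑ i, c i ^ 2) / 4)) := by
    rw [Complex.exp_eq_exp_ℂ]
    exact NormedSpace.expSeries_div_hasSum_exp _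
  have hinj : Function.Injective fun q : ℕ => 2 * q := fun a b h => by simpa using h
  -- The exponential is a series in `s²`, so only the even indices `L = 2q` carry a term.
  rw [← hinj.hasSum_iff]
  · refine (hE.mul_left _).congr_fun (fun q => ?_)
    simp only [Function.comp, even_two_mul, if_true, Nat.mul_div_cancel_left q two_pos]
    rw [mul_div_assoc, mul_pow, ← pow_mul]
    ring
  · intro L hL
    rw [if_neg, mul_zero]
    rintro ⟨q, rfl⟩
    exact hL ⟨q, by simp only; ring⟩

/-! ### Moments of linear forms on the unit sphere -/

theorem integral_radial_gaussian (L : ℕ) :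
    ∫ r in Set.Ioi (0 : ℝ), ((r ^ 2 : ℝ) : ℂ) * ((r : ℂ) ^ L * Complex.exp (-(r : ℂ) ^ 2)) =
      ((Real.Gamma ((L + 3) / 2) / 2 : ℝ) : ℂ) := by
  have h := integral_rpow_mul_exp_neg_rpow (p := 2) (q := (L + 2 : ℕ)) two_pos
    (by push_cast; linarith [(Nat.cast_nonneg L : (0 : ℝ) ≤ L)])
  have : Real.Gamma ((L + 3) / 2) / 2 = 1 / 2 * Real.Gamma ((((L + 2 : ℕ) : ℝ) + 1) / 2) := by
    push_cast
    ring_nf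
  rw [this, ← h, ← integral_complex_ofReal]
  refine setIntegral_congr_fun measurableSet_Ioi fun r hr => ?_
  simp only [Real.rpow_natCast, Real.rpow_two]
  push_cast
  ring

/-- By homogeneity `(c·x)^L = r^L (c·ω)^L`, so polar coordinates split off a positive Gamma factor,
which can be divided out to recover the sphere moment. -/
theorem radial_mul_sphere_moment (c : Fin 3 → ℂ) (L : ℕ) :
    ∫ x : E3, cdot c x ^ L * Complex.exp (-(‖x‖ : ℂ) ^ 2) =
      ((Real.Gamma ((L + 3) / 2) / 2 : ℝ) : ℂ) * ∫ ω, cdot c ω ^ L ∂sphereMeasure := by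
  rw [← integral_radial_gaussian, ← integral_radial_mul_angular
    (fun r => (r : ℂ) ^ L * Complex.exp (-(r : ℂ) ^ 2)) (fun x => cdot c x ^ L)]
  refine integral_congr_ae (Filter.Eventually.of_forall fun x => ?_)
  simp only []
  rw [cdot_eq_norm_mul c x, mul_pow]
  ring

theorem sphere_moment_of_odd (c : Fin 3 → ℂ) {L : ℕ} (hL : ¬ Even L) :
    ∫ ω, cdot c ω ^ L ∂sphereMeasure = 0 := by
  have h := gaussian_moments c L
  rw [if_neg hL, div_eq_zero_iff, radial_mul_sphere_moment, mul_eq_zero] at h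
  have hG : ((Real.Gamma ((L + 3) / 2) / 2 : ℝ) : ℂ) ≠ 0 := by
    exact_mod_cast (div_pos (Real.Gamma_pos_of_pos (by positivity)) two_pos).ne'
  have hf : (L ! : ℂ) ≠ 0 := by exact_mod_cast L.factorial_ne_zero
  tauto

theorem factorial_two_mul_add_one (q : ℕ) :
    (2 * q + 1)! = (2 * q + 1)‼ * (2 ^ q * q !) := by
  rw [Nat.factorial_eq_mul_doubleFactorial, Nat.doubleFactorial_two_mul]

theorem sphere_moment_two_mul (c : Fin 3 → ℂ) (q : ℕ) :
    ∫ ω, cdot c ω ^ (2 * q) ∂sphereMeasure =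
      4 * Real.pi / (2 * q + 1) * (∑ i, c i ^ 2) ^ q := by
  have h := gaussian_moments c (2 * q)
  rw [if_pos (even_two_mul q), radial_mul_sphere_moment, Nat.mul_div_cancel_left q two_pos] at h
  -- This is `Γ` at the half-integer `(q + 1) + 1/2`; its double factorial cancels against the one
  -- in `(2q+1)!`.
  have hG : Real.Gamma (((2 * q : ℕ) + 3) / 2) = (2 * q + 1)‼ * √Real.pi / 2 ^ (q + 1) := by
    have := Real.Gamma_nat_add_half (q + 1)
    rw [show 2 * (q + 1) - 1 = 2 * q + 1 by omega] at this
    rw [← this]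
    push_cast
    ring_nf
  have hpi : (Real.pi : ℂ) ^ (1 / 2 : ℂ) = (√Real.pi : ℝ) := by
    rw [Real.sqrt_eq_rpow, Complex.ofReal_cpow Real.pi_pos.le]
    norm_num
  have hs : ((√Real.pi : ℝ) : ℂ) ^ 2 = Real.pi := by
    rw [← Complex.ofReal_pow, Real.sq_sqrt Real.pi_pos.le]
  have hs0 : ((√Real.pi : ℝ) : ℂ) ≠ 0 := by
    exact_mod_cast (Real.sqrt_pos.2 Real.pi_pos).ne'
  have hf := congrArg (Nat.cast (R := ℂ)) (factorial_two_mul_add_one q)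
  rw [Nat.factorial_succ] at hf
  push_cast at hf
  have hf0 : ((2 * q)! : ℂ) ≠ 0 := by exact_mod_cast (2 * q).factorial_ne_zero
  have hq0 : (q ! : ℂ) ≠ 0 := by exact_mod_cast q.factorial_ne_zero
  have hd0 : ((2 * q + 1)‼ : ℂ) ≠ 0 := by exact_mod_cast (Nat.doubleFactorial_pos _).ne'
  have hq1 : (2 * q + 1 : ℂ) ≠ 0 := by exact_mod_cast (2 * q).succ_ne_zero
  rw [hG, hpi, pow_succ _ 2, hs, div_pow] at h
  push_cast at h
  have h4 : (4 : ℂ) ^ q = 2 ^ q * 2 ^ q := by rw [← mul_pow]; norm_num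
  rw [h4] at h
  rw [div_eq_iff hf0] at h
  set S := ∫ ω, cdot c ω ^ (2 * q) ∂sphereMeasure
  set κ := ∑ i, c i ^ 2
  have h2 : (2 : ℂ) ^ q ≠ 0 := pow_ne_zero _ two_ne_zero
  rw [pow_succ (2 : ℂ) q] at h
  field_simp at h ⊢
  have hfin : ((2 * q + 1)‼ : ℂ) * (2 ^ q * q !) * S * (2 * q + 1)
      = ((2 * q + 1)‼ : ℂ) * (2 ^ q * q !) * (4 * Real.pi * κ ^ q) := by
    linear_combination (2 * q + 1 : ℂ) * h + 4 * Real.pi * κ ^ q * hf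
  exact mul_left_cancel₀ (mul_ne_zero hd0 (mul_ne_zero h2 hq0)) (by linear_combination hfin)

/-! ### Polarization and mixed moments -/

theorem eq_of_sum_pow_mul_eq {M : ℕ} {α β : ℕ → ℂ}
    (h : ∀ s : ℂ, ∑ i ∈ Finset.range M, s ^ i * α i = ∑ i ∈ Finset.range M, s ^ i * β i)
    {i : ℕ} (hi : i < M) : α i = β i := by
  have hp : ∑ i ∈ Finset.range M, Polynomial.monomial i (α i) =
      ∑ i ∈ Finset.range M, Polynomial.monomial i (β i) := by
    refine Polynomial.funext fun s => ?_
    simpa [Polynomial.eval_finsetSum, Polynomial.eval_monomial, mul_comm] using h s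
  simpa [Polynomial.finsetSum_coeff, Polynomial.coeff_monomial, hi] using
    congrArg (fun p => p.coeff i) hp

theorem integrable_of_continuous {F : E3 → ℂ} (hF : Continuous F) :
    Integrable (fun ω : Metric.sphere (0 : E3) 1 => F ω) sphereMeasure :=
  (hF.comp continuous_subtype_val).integrable_of_hasCompactSupport
    (HasCompactSupport.of_compactSpace _)

/-- Seen as a polynomial in `s`, the moment of `s a + b` has the mixed moments of `a` and `b` as
coefficients, up to binomials. -/
theorem sphere_moment_add (a b : Fin 3 → ℂ) (s : ℂ) (L : ℕ) :
    ∫ ω, cdot (s • a + b) ω ^ L ∂sphereMeasure = ∑ i ∈ Finset.range (L + 1),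
      s ^ i * (L.choose i * ∫ ω, cdot a ω ^ i * cdot b ω ^ (L - i) ∂sphereMeasure) := by
  have ha := continuous_cdot a
  have hb := continuous_cdot b
  have : ∀ ω : Metric.sphere (0 : E3) 1, cdot (s • a + b) ω ^ L = ∑ i ∈ Finset.range (L + 1),
      s ^ i * (L.choose i * (cdot a ω ^ i * cdot b ω ^ (L - i))) := fun ω => by
    rw [cdot_add_left, cdot_smul_left, add_pow]
    exact Finset.sum_congr rfl fun i _ => by ring
  simp only [this]
  rw [integral_finsetSum]
  · simp only [integral_const_mul]
  · exact fun i _ => integrable_of_continuous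
      (F := fun x => s ^ i * (L.choose i * (cdot a x ^ i * cdot b x ^ (L - i)))) (by fun_prop)

theorem sphere_mixed_moment_of_odd (a b : Fin 3 → ℂ) {n l : ℕ} (h : ¬ Even (n + l)) :
    ∫ ω, cdot a ω ^ n * cdot b ω ^ l ∂sphereMeasure = 0 := by
  have key := eq_of_sum_pow_mul_eq (M := n + l + 1)
    (α := fun i => (n + l).choose i * ∫ ω, cdot a ω ^ i * cdot b ω ^ (n + l - i) ∂sphereMeasure)
    (β := fun _ => 0) (fun s => by
      rw [← sphere_moment_add, sphere_moment_of_odd _ h]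
      simp) (i := n) (by omega)
  rw [Nat.add_sub_cancel_left, mul_eq_zero] at key
  exact key.resolve_left (by exact_mod_cast (Nat.choose_pos (by omega)).ne')

/-- Mixed moments of an isotropic vector `a` and an arbitrary vector `b`. -/
theorem sphere_mixed_moment (a b : Fin 3 → ℂ) (ha : ∑ i, a i ^ 2 = 0) {n l q : ℕ}
    (h : n + l = 2 * q) :
    ((2 * q).choose n : ℂ) * ∫ ω, cdot a ω ^ n * cdot b ω ^ l ∂sphereMeasure =
      4 * Real.pi / (2 * q + 1) *
        (q.choose n * (2 * ∑ i, a i * b i) ^ n * (∑ i, b i ^ 2) ^ (q - n)) := by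
  have key := eq_of_sum_pow_mul_eq (M := 2 * q + 1)
    (α := fun i => (2 * q).choose i * ∫ ω, cdot a ω ^ i * cdot b ω ^ (2 * q - i) ∂sphereMeasure)
    (β := fun i => 4 * Real.pi / (2 * q + 1) *
        (q.choose i * (2 * ∑ i, a i * b i) ^ i * (∑ i, b i ^ 2) ^ (q - i))) (fun s => by
      rw [← sphere_moment_add, sphere_moment_two_mul]
      -- Isotropy of `a` removes the `s²` term, leaving an affine function of `s` whose `q`-th power
      -- is expanded binomially.
      have hs : ∑ i, (s • a + b) i ^ 2 = s * (2 * ∑ i, a i * b i) + ∑ i, b i ^ 2 := by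
        have : ∑ i, (s • a + b) i ^ 2 =
            s ^ 2 * ∑ i, a i ^ 2 + s * (2 * ∑ i, a i * b i) + ∑ i, b i ^ 2 := by
          simp only [Finset.mul_sum, ← Finset.sum_add_distrib, Pi.add_apply, Pi.smul_apply,
            smul_eq_mul]
          exact Finset.sum_congr rfl fun i _ => by ring
        rw [this, ha, mul_zero, zero_add]
      rw [hs, add_pow, Finset.mul_sum]
      -- That expansion stops at degree `q`; for `q < i ≤ 2q` the binomial coefficient is zero.
      refine (Finset.sum_subset (Finset.range_subset_range.2 (by omega)) fun i _ hi => ?_).trans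
        (Finset.sum_congr rfl fun i _ => by ring)
      rw [Nat.choose_eq_zero_of_lt (by simpa using hi)]
      simp) (i := n) (by omega)
  simpa [show 2 * q - n = l by omega] using key

/-- Powers of isotropic linear forms of different degrees are orthogonal on the sphere. -/
theorem sphere_isotropic_orthogonal (a b : Fin 3 → ℂ) (ha : ∑ i, a i ^ 2 = 0)
    (hb : ∑ i, b i ^ 2 = 0) {n l : ℕ} (h : n ≠ l) :
    ∫ ω, cdot a ω ^ n * cdot b ω ^ l ∂sphereMeasure = 0 := by
  by_cases he : Even (n + l)
  · obtain ⟨q, hq⟩ := he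
    have key := sphere_mixed_moment a b ha (show n + l = 2 * q by omega)
    -- If `q < n` the binomial vanishes. Otherwise `n ≠ l` forces `q > n`, and a positive power of
    -- `b·b = 0` remains.
    have h0 : (q.choose n : ℂ) * (2 * ∑ i, a i * b i) ^ n * (∑ i, b i ^ 2) ^ (q - n) = 0 := by
      rcases lt_or_ge q n with hlt | hge
      · simp [Nat.choose_eq_zero_of_lt hlt]
      · rw [hb, zero_pow (by omega), mul_zero]
    rw [h0, mul_zero, mul_eq_zero] at key
    exact key.resolve_left (by exact_mod_cast (Nat.choose_pos (by omega)).ne')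
  · exact sphere_mixed_moment_of_odd a b he

/-! ### The Funk–Hecke formula for isotropic powers -/

theorem cdot_ofReal (ξ x : E3) : cdot (fun i => (ξ i : ℂ)) x = (inner ℝ ξ x : ℝ) := by
  simp [cdot, PiLp.inner_apply, mul_comm]

theorem sum_ofReal_sq (ξ : E3) : ∑ i, (ξ i : ℂ) ^ 2 = (‖ξ‖ : ℂ) ^ 2 := by
  rw [← Complex.ofReal_pow, EuclideanSpace.norm_sq_eq]
  simp

theorem hasSum_sphericalBessel (n : ℕ) (t : ℝ) :
    HasSum (fun p : ℕ => (-1) ^ p * t ^ (n + 2 * p) /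
      (2 ^ p * (p ! : ℝ) * ((2 * n + 2 * p + 1)‼ : ℝ))) (sphericalBessel n t) :=
  (Summable.of_norm_bounded ((Real.summable_pow_div_factorial (|t| ^ 2)).mul_left (|t| ^ n))
    fun p => sphericalBessel_term_le n p le_rfl).hasSum

/-- Taking `b = ξ` and `q = n + p` in `sphere_mixed_moment`, the identity `(2q+1)! = (2q+1)‼ 2^q q!`
collapses the binomials and factorials to the denominator of the `p`-th Bessel term. -/
theorem sphere_mixed_moment_ofReal (a : Fin 3 → ℂ) (ha : ∑ i, a i ^ 2 = 0) (n p : ℕ) (ξ : E3) :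
    (∫ ω, cdot a ω ^ n * cdot (fun i => (ξ i : ℂ)) ω ^ (n + 2 * p) ∂sphereMeasure) /
        ((n + 2 * p)! : ℂ) =
      4 * Real.pi * (cdot a ξ ^ n * (‖ξ‖ : ℂ) ^ (2 * p) /
        (2 ^ p * (p ! : ℂ) * ((2 * n + 2 * p + 1)‼ : ℂ))) := by
  have key := sphere_mixed_moment a (fun i => (ξ i : ℂ)) ha
    (show n + (n + 2 * p) = 2 * (n + p) by ring)
  rw [sum_ofReal_sq, Nat.add_sub_cancel_left] at key
  change _ = _ * (_ * (2 * cdot a ξ) ^ n * _) at key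
  have h1 := congrArg (Nat.cast (R := ℂ)) (Nat.add_choose_mul_factorial_mul_factorial (n + 2 * p) n)
  have h2 := congrArg (Nat.cast (R := ℂ)) (Nat.add_choose_mul_factorial_mul_factorial p n)
  have h3 := congrArg (Nat.cast (R := ℂ)) (factorial_two_mul_add_one (n + p))
  rw [Nat.factorial_succ] at h3
  rw [show n + 2 * p + n = 2 * (n + p) by ring] at h1
  rw [add_comm p n] at h2
  rw [show 2 * n + 2 * p + 1 = 2 * (n + p) + 1 by ring]
  push_cast at h1 h2 h3 key
  have hq1 : (2 * (n + p) + 1 : ℂ) ≠ 0 := by exact_mod_cast (2 * (n + p)).succ_ne_zero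
  have hp0 : (p ! : ℂ) ≠ 0 := by exact_mod_cast p.factorial_ne_zero
  have hn0 : (n ! : ℂ) ≠ 0 := by exact_mod_cast n.factorial_ne_zero
  have hl0 : ((n + 2 * p)! : ℂ) ≠ 0 := by exact_mod_cast (n + 2 * p).factorial_ne_zero
  have hd0 : ((2 * (n + p) + 1)‼ : ℂ) ≠ 0 := by exact_mod_cast (Nat.doubleFactorial_pos _).ne'
  have hc0 : ((2 * (n + p)).choose n : ℂ) ≠ 0 := by
    exact_mod_cast (Nat.choose_pos (by omega)).ne'
  have hC : ((n + p).choose n : ℂ) ≠ 0 := by exact_mod_cast (Nat.choose_pos (by omega)).ne'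
  set A := ∫ ω, cdot a ω ^ n * cdot (fun i => (ξ i : ℂ)) ω ^ (n + 2 * p) ∂sphereMeasure
  set C1 : ℂ := ((2 * (n + p)).choose n : ℂ)
  set C2 : ℂ := ((n + p).choose n : ℂ)
  set D : ℂ := ((2 * (n + p) + 1)‼ : ℂ)
  set Q : ℂ := (2 * (n + p) + 1 : ℂ)
  have e2 : (2 : ℂ) ^ (n + p) = 2 ^ n * 2 ^ p := pow_add _ _ _
  rw [mul_pow, ← pow_mul] at key
  rw [← h1, ← h2, e2] at h3
  set X := cdot a ξ ^ n
  set T := (‖ξ‖ : ℂ) ^ (2 * p)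
  have h2n : (2 : ℂ) ^ n ≠ 0 := pow_ne_zero _ two_ne_zero
  have h2p : (2 : ℂ) ^ p ≠ 0 := pow_ne_zero _ two_ne_zero
  have h3' : Q * C1 * (n + 2 * p)! = D * (2 ^ n * 2 ^ p * C2 * p !) := by
    refine mul_right_cancel₀ hn0 ?_
    linear_combination h3
  rw [div_eq_iff hl0]
  field_simp at key ⊢
  refine mul_left_cancel₀ (mul_ne_zero (mul_ne_zero h2n hC) (mul_ne_zero hq1 hc0)) ?_
  linear_combination (2 ^ n * C2 * 2 ^ p * p ! * D) * key - (4 * Real.pi * X * T * 2 ^ n * C2) * h3'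

/-- The Funk–Hecke formula for powers of isotropic linear forms. -/
theorem funkHecke_isotropic (a : Fin 3 → ℂ) (ha : ∑ i, a i ^ 2 = 0) (n : ℕ) (ξ : E3) :
    ∫ ω, cdot a ω ^ n * Complex.exp (Complex.I * (inner ℝ ξ (ω : E3) : ℝ)) ∂sphereMeasure =
      4 * Real.pi * Complex.I ^ n *
        ((sphericalBessel n ‖ξ‖ : ℂ) * cdot a (‖ξ‖⁻¹ • ξ) ^ n) := by
  have hE : ∀ z : ℂ, HasSum (fun L : ℕ => z ^ L / (L ! : ℂ)) (Complex.exp z) := fun z => by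
    rw [Complex.exp_eq_exp_ℂ]
    exact NormedSpace.expSeries_div_hasSum_exp z
  have hE' : ∀ z : ℝ, HasSum (fun L : ℕ => z ^ L / (L ! : ℝ)) (Real.exp z) := fun z => by
    rw [Real.exp_eq_exp_ℝ]
    exact NormedSpace.expSeries_div_hasSum_exp z
  have hca := continuous_cdot a
  have hcx := continuous_cdot (fun i => (ξ i : ℂ))
  have h1 := hasSum_integral_of_dominated_convergence
    (F := fun (l : ℕ) (ω : Metric.sphere (0 : E3) 1) => cdot a ω ^ n *
      ((Complex.I * cdot (fun i => (ξ i : ℂ)) ω) ^ l / (l ! : ℂ)))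
    (f := fun ω => cdot a ω ^ n * Complex.exp (Complex.I * cdot (fun i => (ξ i : ℂ)) ω))
    (μ := sphereMeasure)
    (fun (l : ℕ) ω => ‖cdot a ω ^ n‖ *
      (‖Complex.I * cdot (fun i => (ξ i : ℂ)) ω‖ ^ l / (l ! : ℝ)))
    (fun l => (integrable_of_continuous (F := fun x => cdot a x ^ n *
      ((Complex.I * cdot (fun i => (ξ i : ℂ)) x) ^ l / (l ! : ℂ)))
      (by fun_prop)).aestronglyMeasurable)
    (fun l => Filter.Eventually.of_forall fun ω => by
      rw [norm_mul, norm_div, norm_pow _ l, Complex.norm_natCast])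
    (Filter.Eventually.of_forall fun ω => ((hE' _).mul_left _).summable)
    (by
      simp only [fun ω : Metric.sphere (0 : E3) 1 =>
        ((hE' ‖Complex.I * cdot (fun i => (ξ i : ℂ)) ω‖).mul_left ‖cdot a ω ^ n‖).tsum_eq]
      have hc : Continuous fun x : E3 => ‖cdot a x ^ n‖ *
        Real.exp ‖Complex.I * cdot (fun i => (ξ i : ℂ)) x‖ := by fun_prop
      exact (hc.comp continuous_subtype_val).integrable_of_hasCompactSupport
        (HasCompactSupport.of_compactSpace _))
    (Filter.Eventually.of_forall fun ω => (hE _).mul_left _)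
  have h2 : HasSum (fun p : ℕ => 4 * Real.pi * Complex.I ^ n *
      ((((-1) ^ p * ‖ξ‖ ^ (n + 2 * p) / (2 ^ p * (p ! : ℝ) * ((2 * n + 2 * p + 1)‼ : ℝ)) : ℝ) : ℂ) *
        cdot a (‖ξ‖⁻¹ • ξ) ^ n))
      (4 * Real.pi * Complex.I ^ n *
        ((sphericalBessel n ‖ξ‖ : ℂ) * cdot a (‖ξ‖⁻¹ • ξ) ^ n)) :=
    ((Complex.hasSum_ofReal.2 (hasSum_sphericalBessel n ‖ξ‖)).mul_right _).mul_left _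
  have hF : ∀ l : ℕ, ∫ ω, cdot a ω ^ n *
      ((Complex.I * cdot (fun i => (ξ i : ℂ)) ω) ^ l / (l ! : ℂ)) ∂sphereMeasure =
      Complex.I ^ l * ((∫ ω, cdot a ω ^ n * cdot (fun i => (ξ i : ℂ)) ω ^ l ∂sphereMeasure) /
        (l ! : ℂ)) := fun l => by
    rw [← integral_div, ← integral_const_mul]
    refine integral_congr_ae (Filter.Eventually.of_forall fun ω => ?_)
    simp only [mul_pow]
    ring
  simp only [hF] at h1
  simp only [cdot_ofReal] at h1 ⊢
  -- Only the exponents `l = n + 2p` of the plane wave series contribute, and `i^(n+2p) = i^n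
  -- (-1)^p` supplies the signs of the Bessel series.
  have hinj : Function.Injective fun p : ℕ => n + 2 * p := fun a b h => by
    simp only at h
    omega
  have h3 := (hinj.hasSum_iff fun l hl => ?_).2 h1
  · refine h3.unique (h2.congr_fun fun p => ?_)
    have := sphere_mixed_moment_ofReal a ha n p ξ
    simp only [cdot_ofReal] at this
    simp only [Function.comp, this]
    rw [cdot_eq_norm_mul a ξ, mul_pow, pow_add Complex.I, pow_mul Complex.I, Complex.I_sq]
    push_cast
    rw [pow_add]
    ring
  -- Any other `l` has the wrong parity or satisfies `l < n`; in the latter case `(n + l)/2 < n`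
  -- kills the binomial coefficient.
  · have h0 : ∫ ω, cdot a ω ^ n * cdot (fun i => (ξ i : ℂ)) ω ^ l ∂sphereMeasure = 0 := by
      by_cases he : Even (n + l)
      · obtain ⟨q, hq⟩ := he
        have key := sphere_mixed_moment a (fun i => (ξ i : ℂ)) ha (show n + l = 2 * q by omega)
        have hlt : q < n := by
          by_contra hge
          exact hl ⟨q - n, by simp only; omega⟩
        rw [Nat.choose_eq_zero_of_lt hlt] at key
        simp only [Nat.cast_zero, zero_mul, mul_zero, mul_eq_zero] at key
        exact key.resolve_left (by exact_mod_cast (Nat.choose_pos (by omega)).ne')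
      · exact sphere_mixed_moment_of_odd a _ he
    simp only [cdot_ofReal] at h0
    rw [h0]
    simp

/-! ### Spherical harmonics as sums of isotropic powers -/

-- Multiplying the quadratic by `w` completes the square: with `w w' = 1 - z²` it becomes `(z + wX)²
-- - 1`. The coefficients of its `n`-th power are therefore Taylor coefficients of `(X² - 1)^n` at
-- `z`, scaled by powers of `w`.
open Polynomial in
theorem coeff_isotropic_pow {n m : ℕ} {z : ℝ} {w w' : ℂ} (h : w * w' = 1 - (z : ℂ) ^ 2)
    (h0 : w = 0 → w' = 0) :
    ((C w * X ^ 2 + C (2 * (z : ℂ)) * X - C w') ^ n).coeff (n + m) =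
      w ^ m * ((((X ^ 2 - 1 : ℝ[X]) ^ n).hasseDeriv (n + m)).eval z : ℝ) := by
  have hT : (((((X ^ 2 - 1 : ℝ[X]) ^ n).hasseDeriv (n + m)).eval z : ℝ) : ℂ) =
      ((X ^ 2 + C (2 * (z : ℂ)) * X - C (1 - (z : ℂ) ^ 2)) ^ n).coeff (n + m) := by
    rw [← taylor_coeff]
    have : ((taylor z ((X ^ 2 - 1 : ℝ[X]) ^ n)).map Complex.ofRealHom) =
        (X ^ 2 + C (2 * (z : ℂ)) * X - C (1 - (z : ℂ) ^ 2)) ^ n := by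
      rw [taylor_pow, Polynomial.map_pow, taylor_apply]
      congr 1
      simp only [sub_comp, pow_comp, X_comp, one_comp, Polynomial.map_sub, Polynomial.map_pow,
        Polynomial.map_add, map_X, map_C, Complex.ofRealHom_eq_coe, Polynomial.map_one, map_sub,
        map_mul, map_pow, map_one, map_ofNat]
      ring
    rw [← this, coeff_map, Complex.ofRealHom_eq_coe]
  rw [hT]
  -- At the poles one cannot divide by `w^n`; there `w' = 0` and `z² = 1`, and the quadratic
  -- degenerates to `2zX`.
  by_cases hw : w = 0
  · have hw' := h0 hw
    subst hw
    rw [hw', zero_mul] at h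
    rw [hw', ← h]
    simp only [map_zero, zero_mul, zero_add, sub_zero]
    rcases Nat.eq_zero_or_pos m with rfl | hm
    · have : (X ^ 2 + C (2 * (z : ℂ)) * X : ℂ[X]) = X * (X + C (2 * (z : ℂ))) := by ring
      rw [this, mul_pow, mul_pow, add_zero, coeff_X_pow_mul', if_pos le_rfl, Nat.sub_self,
        ← C_pow, coeff_C_mul, coeff_X_pow, if_pos rfl, coeff_zero_eq_eval_zero]
      simp
    · rw [mul_pow, ← C_pow, coeff_C_mul, coeff_X_pow, if_neg (by omega), zero_pow hm.ne']
      simp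
  · have hc : C (w ^ n) * (C w * X ^ 2 + C (2 * (z : ℂ)) * X - C w') ^ n =
        ((X ^ 2 + C (2 * (z : ℂ)) * X - C (1 - (z : ℂ) ^ 2)) ^ n).comp (C w * X) := by
      rw [C_pow, ← mul_pow, pow_comp, ← h]
      congr 1
      simp only [sub_comp, add_comp, mul_comp, pow_comp, X_comp, C_comp, map_mul]
      ring
    have := congrArg (fun p => p.coeff (n + m)) hc
    simp only [coeff_C_mul, comp_C_mul_X_coeff] at this
    refine mul_left_cancel₀ (pow_ne_zero n hw) ?_
    rw [this, pow_add]
    ring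

/-- The family of isotropic vectors generating the spherical harmonics. -/
noncomputable def isotropicVec (e τ : ℂ) : Fin 3 → ℂ := ![τ ^ 2 - 1, e * (τ ^ 2 + 1), 2 * τ]

theorem isotropicVec_isotropic {e : ℂ} (he : e ^ 2 = -1) (τ : ℂ) :
    ∑ i, isotropicVec e τ i ^ 2 = 0 := by
  simp only [isotropicVec, Fin.sum_univ_three, Matrix.cons_val_zero, Matrix.cons_val_one,
    Matrix.cons_val]
  rw [mul_pow, he]
  ring

/-- Rodrigues' formula written with a Hasse derivative, which is the Taylor coefficient occurring in
`coeff_isotropic_pow`. -/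
theorem derivative_legendreP_eval (n m : ℕ) (z : ℝ) :
    (Polynomial.derivative^[m] (legendreP n)).eval z =
      (n + m)! / (2 ^ n * n !) *
        ((((Polynomial.X ^ 2 - 1 : Polynomial ℝ) ^ n).hasseDeriv (n + m)).eval z) := by
  rw [legendreP, Polynomial.iterate_derivative_C_mul, ← Function.iterate_add_apply, add_comm m n,
    ← Polynomial.factorial_smul_hasseDeriv]
  simp
  ring

/-- On the unit sphere, a spherical harmonic of degree `n` is a linear combination of `n`-th powers
of isotropic linear forms. -/
theorem sphericalHarmonic_eq_sum (n : ℕ) (m : ℤ) :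
    ∃ (β : ℕ → ℂ) (a : ℕ → Fin 3 → ℂ), (∀ j, ∑ i, a j i ^ 2 = 0) ∧
      ∀ x : E3, (n = 0 ∧ m = 0) ∨ ‖x‖ = 1 → sphericalHarmonic n m x =
        ∑ j ∈ Finset.range (2 * n + 1), β j * cdot (a j) x ^ n := by
  obtain ⟨e, he⟩ : ∃ e : ℂ, e = if 0 ≤ m then Complex.I else -Complex.I := ⟨_, rfl⟩
  have he2 : e ^ 2 = -1 := by rw [he]; split_ifs <;> simp
  set μ := m.natAbs with hμ
  set γ : ℂ := (Real.sqrt ((2 * n + 1) / (4 * Real.pi) * (((n - μ)! : ℝ) / ((n + μ)! : ℝ))) : ℝ) *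
    (((n + μ)! / (2 ^ n * n !) : ℝ) : ℂ) with hγ
  -- For `a_τ = isotropicVec e τ`, `(a_τ·x)^n` is a polynomial in `τ` of degree at most `2n` whose
  -- coefficient at `τ^(n+|m|)` is proportional to `Y_{nm}(x)`. Lagrange interpolation at `τ = 0, …,
  -- 2n` expresses that coefficient through the values at the nodes.
  refine ⟨fun j => γ * (Lagrange.basis (Finset.range (2 * n + 1)) (fun i : ℕ => (i : ℂ)) j).coeff
    (n + μ), fun j => isotropicVec e j, fun j => isotropicVec_isotropic he2 _, fun x hx => ?_⟩
  set w : ℂ := x 0 + e * x 1 with hw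
  set w' : ℂ := x 0 - e * x 1 with hw'
  have hY : sphericalHarmonic n m x = γ * (w ^ μ *
      ((((Polynomial.X ^ 2 - 1 : Polynomial ℝ) ^ n).hasseDeriv (n + μ)).eval (x 2) : ℝ)) := by
    have hwe : (if 0 ≤ m then (x 0 : ℂ) + Complex.I * (x 1 : ℂ)
        else (x 0 : ℂ) - Complex.I * (x 1 : ℂ)) = w := by
      rw [hw, he]
      split_ifs <;> ring
    rw [sphericalHarmonic, hwe, ← hμ, derivative_legendreP_eval, hγ]
    push_cast
    ring
  set P : Polynomial ℂ := Polynomial.C w * Polynomial.X ^ 2 +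
    Polynomial.C (2 * (x 2 : ℂ)) * Polynomial.X - Polynomial.C w' with hP
  have hcoeff : (P ^ n).coeff (n + μ) = w ^ μ *
      ((((Polynomial.X ^ 2 - 1 : Polynomial ℝ) ^ n).hasseDeriv (n + μ)).eval (x 2) : ℝ) := by
    rcases hx with ⟨rfl, rfl⟩ | hx
    · simp [hμ]
    · refine coeff_isotropic_pow ?_ fun h => ?_
      · have h1 : (x 0 : ℂ) ^ 2 + (x 1 : ℂ) ^ 2 + (x 2 : ℂ) ^ 2 = 1 := by
          have := sum_ofReal_sq x
          rwa [Fin.sum_univ_three, hx, Complex.ofReal_one, one_pow] at this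
        rw [hw, hw']
        linear_combination h1 - (x 1 : ℂ) ^ 2 * he2
      · have h01 : x 0 = 0 ∧ x 1 = 0 := by
          rw [hw, he] at h
          split_ifs at h <;>
          · have hr := congrArg Complex.re h
            have hi := congrArg Complex.im h
            simp at hr hi
            exact ⟨hr, hi⟩
        rw [hw', h01.1, h01.2]
        simp
  have hdeg : (P ^ n).degree < ((Finset.range (2 * n + 1)).card : WithBot ℕ) := by
    rw [Finset.card_range]
    have h2 : P.natDegree ≤ 2 := by
      rw [hP]
      compute_degree
    refine lt_of_le_of_lt Polynomial.degree_le_natDegree ?_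
    have := Polynomial.natDegree_pow_le_of_le n h2
    exact_mod_cast (by omega : (P ^ n).natDegree < 2 * n + 1)
  have hinj : Set.InjOn (fun i : ℕ => (i : ℂ)) (Finset.range (2 * n + 1)) :=
    Nat.cast_injective.injOn
  rw [hY, ← hcoeff, Lagrange.eq_interpolate hinj hdeg, Lagrange.interpolate_apply,
    Polynomial.finsetSum_coeff, Finset.mul_sum]
  refine Finset.sum_congr rfl fun j _ => ?_
  have hev : Polynomial.eval (j : ℂ) P = cdot (isotropicVec e j) x := by
    simp [hP, hw, hw', cdot, isotropicVec, Fin.sum_univ_three]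
    ring
  rw [Polynomial.coeff_C_mul, Polynomial.eval_pow, hev]
  ring

theorem sphericalBessel_zero_right {n : ℕ} (hn : n ≠ 0) : sphericalBessel n 0 = 0 := by
  unfold sphericalBessel
  simp [hn]

/-- The Funk–Hecke formula for spherical harmonics: plane waves are mapped to spherical waves. -/
theorem funkHecke {n : ℕ} {m : ℤ} (hm : m.natAbs ≤ n) (ξ : E3) :
    ∫ ω, sphericalHarmonic n m ω * Complex.exp (Complex.I * (inner ℝ ξ (ω : E3) : ℝ))
        ∂sphereMeasure =
      4 * Real.pi * Complex.I ^ n *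
        ((sphericalBessel n ‖ξ‖ : ℂ) * sphericalHarmonic n m (‖ξ‖⁻¹ • ξ)) := by
  obtain ⟨β, a, ha, hY⟩ := sphericalHarmonic_eq_sum n m
  have h1 : ∀ ω : Metric.sphere (0 : E3) 1, sphericalHarmonic n m ω *
      Complex.exp (Complex.I * (inner ℝ ξ (ω : E3) : ℝ)) = ∑ j ∈ Finset.range (2 * n + 1),
        β j * (cdot (a j) ω ^ n * Complex.exp (Complex.I * (inner ℝ ξ (ω : E3) : ℝ))) := fun ω => by
    rw [hY ω (Or.inr (norm_eq_of_mem_sphere ω)), Finset.sum_mul]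
    exact Finset.sum_congr rfl fun j _ => by ring
  simp only [h1]
  rw [integral_finsetSum]
  · have h2 : (sphericalBessel n ‖ξ‖ : ℂ) * sphericalHarmonic n m (‖ξ‖⁻¹ • ξ) =
        (sphericalBessel n ‖ξ‖ : ℂ) *
          ∑ j ∈ Finset.range (2 * n + 1), β j * cdot (a j) (‖ξ‖⁻¹ • ξ) ^ n := by
      -- At `ξ = 0` the direction `‖ξ‖⁻¹ • ξ` is `0`, not a unit vector. For `n = 0` the
      -- representation still holds there; for `n ≠ 0` the factor `j_n(0) = 0` hides the failure.
      by_cases h0 : n = 0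
      · rw [hY _ (Or.inl ⟨h0, by omega⟩)]
      · by_cases hξ : ξ = 0
        · rw [hξ, norm_zero, sphericalBessel_zero_right h0, Complex.ofReal_zero, zero_mul, zero_mul]
        · rw [hY _ (Or.inr (by rw [norm_smul, norm_inv, norm_norm,
            inv_mul_cancel₀ (norm_ne_zero_iff.2 hξ)]))]
    rw [h2, Finset.mul_sum, Finset.mul_sum]
    refine Finset.sum_congr rfl fun j _ => ?_
    rw [integral_const_mul, funkHecke_isotropic _ (ha j)]
    ring
  · intro j _
    have := continuous_cdot (a j)
    exact integrable_of_continuous (F := fun x => β j * (cdot (a j) x ^ n *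
      Complex.exp (Complex.I * (inner ℝ ξ x : ℝ)))) (by fun_prop)

/-! ### Orthogonality of the spherical waves -/

theorem conj_cdot (a : Fin 3 → ℂ) (x : E3) :
    (starRingEnd ℂ) (cdot a x) = cdot (fun i => (starRingEnd ℂ) (a i)) x := by
  simp [cdot]

/-- Spherical harmonics of different degrees are orthogonal on the unit sphere. -/
theorem sphericalHarmonic_orthogonal_of_degree_ne {n n' : ℕ} (m m' : ℤ) (h : n ≠ n') :
    ∫ ω, sphericalHarmonic n' m' ω * (starRingEnd ℂ) (sphericalHarmonic n m ω)
      ∂sphereMeasure = 0 := by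
  obtain ⟨β, a, ha, hY⟩ := sphericalHarmonic_eq_sum n m
  obtain ⟨β', a', ha', hY'⟩ := sphericalHarmonic_eq_sum n' m'
  have h1 : ∀ ω : Metric.sphere (0 : E3) 1,
      sphericalHarmonic n' m' ω * (starRingEnd ℂ) (sphericalHarmonic n m ω) =
      ∑ i ∈ Finset.range (2 * n' + 1), ∑ j ∈ Finset.range (2 * n + 1),
        β' i * (starRingEnd ℂ) (β j) *
          (cdot (a' i) ω ^ n' * cdot (fun l => (starRingEnd ℂ) (a j l)) ω ^ n) := fun ω => by
    rw [hY ω (Or.inr (norm_eq_of_mem_sphere ω)), hY' ω (Or.inr (norm_eq_of_mem_sphere ω)), map_sum,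
      Finset.sum_mul_sum]
    refine Finset.sum_congr rfl fun i _ => Finset.sum_congr rfl fun j _ => ?_
    rw [map_mul, map_pow, conj_cdot]
    ring
  have hint : ∀ i j, Integrable (fun ω : Metric.sphere (0 : E3) 1 => β' i * (starRingEnd ℂ) (β j) *
      (cdot (a' i) ω ^ n' * cdot (fun l => (starRingEnd ℂ) (a j l)) ω ^ n)) sphereMeasure :=
    fun i j => by
      have h1 := continuous_cdot (a' i)
      have h2 := continuous_cdot (fun l => (starRingEnd ℂ) (a j l))
      exact integrable_of_continuous (F := fun x => β' i * (starRingEnd ℂ) (β j) *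
        (cdot (a' i) x ^ n' * cdot (fun l => (starRingEnd ℂ) (a j l)) x ^ n)) (by fun_prop)
  simp only [h1]
  rw [integral_finsetSum _ fun i _ => integrable_finsetSum _ fun j _ => hint i j]
  refine Finset.sum_eq_zero fun i _ => ?_
  rw [integral_finsetSum _ fun j _ => hint i j]
  refine Finset.sum_eq_zero fun j _ => ?_
  rw [integral_const_mul, sphere_isotropic_orthogonal _ _ (ha' i) _ h.symm, mul_zero]
  -- The conjugate of an isotropic vector is isotropic.
  simpa using congrArg (starRingEnd ℂ) (ha j)

/-- The rotation by the angle `α` about the third axis. -/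
noncomputable def rotation (α : ℝ) : E3 ≃ₗᵢ[ℝ] E3 :=
  (LinearMap.isometryOfInner (𝕜 := ℝ) (E := E3) (E' := E3)
    { toFun := fun x => !₂[Real.cos α * x 0 - Real.sin α * x 1,
        Real.sin α * x 0 + Real.cos α * x 1, x 2]
      map_add' := fun x y => by
        ext i
        fin_cases i <;> simp <;> ring
      map_smul' := fun r x => by
        ext i
        fin_cases i <;> simp <;> ring }
    (fun x y => by
      simp only [LinearMap.coe_mk, AddHom.coe_mk, PiLp.inner_apply, Fin.sum_univ_three,
        RCLike.inner_apply, conj_trivial]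
      simp
      linear_combination (x 0 * y 0 + x 1 * y 1) * Real.sin_sq_add_cos_sq α)).toLinearIsometryEquiv
    rfl

theorem sphericalHarmonic_rotation (n : ℕ) (m : ℤ) (α : ℝ) (x : E3) :
    sphericalHarmonic n m (rotation α x) =
      Complex.exp (Complex.I * m * α) * sphericalHarmonic n m x := by
  have h0 : rotation α x 0 = Real.cos α * x 0 - Real.sin α * x 1 := rfl
  have h1 : rotation α x 1 = Real.sin α * x 0 + Real.cos α * x 1 := rfl
  have h2 : rotation α x 2 = x 2 := rfl
  have key : (if 0 ≤ m then (rotation α x 0 : ℂ) + Complex.I * (rotation α x 1 : ℂ)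
      else (rotation α x 0 : ℂ) - Complex.I * (rotation α x 1 : ℂ)) ^ m.natAbs =
      Complex.exp (Complex.I * m * α) * (if 0 ≤ m then (x 0 : ℂ) + Complex.I * (x 1 : ℂ)
      else (x 0 : ℂ) - Complex.I * (x 1 : ℂ)) ^ m.natAbs := by
    rw [h0, h1]
    have hI := Complex.I_sq
    split_ifs with h
    · have hm : ((m.natAbs : ℕ) : ℂ) = (m : ℂ) := by
        rw [← Int.cast_natCast, Int.natAbs_of_nonneg h]
      have : Complex.exp (Complex.I * m * α) = (Complex.exp (α * Complex.I)) ^ m.natAbs := by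
        rw [← Complex.exp_nat_mul, hm]
        ring_nf
      rw [this, ← mul_pow, Complex.exp_mul_I]
      push_cast
      congr 1
      linear_combination -(Complex.sin α * x 1) * hI
    · have hm : ((m.natAbs : ℕ) : ℂ) = -(m : ℂ) := by
        rw [← Int.cast_natCast, Int.ofNat_natAbs_of_nonpos (by omega), Int.cast_neg]
      have : Complex.exp (Complex.I * m * α) =
          (Complex.exp ((-α : ℂ) * Complex.I)) ^ m.natAbs := by
        rw [← Complex.exp_nat_mul, hm]
        ring_nf
      rw [this, ← mul_pow, Complex.exp_mul_I, Complex.cos_neg, Complex.sin_neg]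
      push_cast
      congr 1
      linear_combination -(Complex.sin α * x 1) * hI
  unfold sphericalHarmonic
  rw [key, h2]
  ring

theorem sphericalWave_rotation (k : ℝ) (n : ℕ) (m : ℤ) (α : ℝ) (x : E3) :
    sphericalWave k n m (rotation α x) =
      Complex.exp (Complex.I * m * α) * sphericalWave k n m x := by
  unfold sphericalWave
  rw [LinearIsometryEquiv.norm_map, ← map_smul, sphericalHarmonic_rotation]
  ring

theorem inner_waveL2_toLp (k R : ℝ) (n : ℕ) (m : ℤ) {g : E3 → ℂ}
    (hg : MemLp g 2 (volume.restrict (Metric.ball (0 : E3) R))) :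
    inner ℂ (waveL2 k R n m) (hg.toLp g) =
      ∫ x in Metric.ball (0 : E3) R, g x * (starRingEnd ℂ) (sphericalWave k n m x) := by
  rw [L2.inner_def]
  refine integral_congr_ae ?_
  filter_upwards [(memLp_sphericalWave k R n m).coeFn_toLp, hg.coeFn_toLp] with x h1 h2
  rw [RCLike.inner_apply, h2]
  congr 2

theorem inner_waveL2_of_order_ne (k R : ℝ) (n n' : ℕ) {m m' : ℤ} (h : m ≠ m') :
    inner ℂ (waveL2 k R n m) (waveL2 k R n' m') = 0 := by
  rw [show waveL2 k R n' m' = (memLp_sphericalWave k R n' m').toLp _ from rfl, inner_waveL2_toLp]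
  set J := ∫ x in Metric.ball (0 : E3) R,
    sphericalWave k n' m' x * (starRingEnd ℂ) (sphericalWave k n m x) with hJ
  have hd : ((m' : ℂ) - m) ≠ 0 := sub_ne_zero.2 (by exact_mod_cast h.symm)
  -- Rotation by `α` multiplies the integrand by `exp(i(m' - m)α)`; this choice makes the factor
  -- `-1`, so invariance of the ball gives `J = -J`.
  obtain ⟨α, hα⟩ : ∃ α : ℝ, α = Real.pi / (m' - m) := ⟨_, rfl⟩
  have hrot := (LinearIsometryEquiv.measurePreserving (rotation α)).setIntegral_preimage_emb
    (rotation α).toHomeomorph.measurableEmbedding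
    (fun x => sphericalWave k n' m' x * (starRingEnd ℂ) (sphericalWave k n m x))
    (Metric.ball (0 : E3) R)
  have hpre : rotation α ⁻¹' Metric.ball (0 : E3) R = Metric.ball (0 : E3) R := by
    ext x
    simp
  have hexp : ∀ x, sphericalWave k n' m' (rotation α x) *
      (starRingEnd ℂ) (sphericalWave k n m (rotation α x)) =
      -1 * (sphericalWave k n' m' x * (starRingEnd ℂ) (sphericalWave k n m x)) := fun x => by
    rw [sphericalWave_rotation, sphericalWave_rotation, map_mul, ← Complex.exp_conj]
    have : Complex.exp (Complex.I * m' * α) *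
        Complex.exp ((starRingEnd ℂ) (Complex.I * m * α)) = -1 := by
      rw [← Complex.exp_add, ← Complex.exp_pi_mul_I]
      congr 1
      simp only [map_mul, Complex.conj_I, Complex.conj_ofReal, map_intCast]
      rw [hα]
      push_cast
      field_simp
      ring
    rw [← this]
    ring
  rw [hpre] at hrot
  simp only [hexp] at hrot
  rw [integral_const_mul, ← hJ] at hrot
  linear_combination (-1 / 2 : ℂ) * hrot

theorem inner_waveL2_of_degree_ne (k R : ℝ) {n n' : ℕ} (m m' : ℤ) (h : n ≠ n') :
    inner ℂ (waveL2 k R n m) (waveL2 k R n' m') = 0 := by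
  rw [show waveL2 k R n' m' = (memLp_sphericalWave k R n' m').toLp _ from rfl, inner_waveL2_toLp,
    ← integral_indicator Metric.isOpen_ball.measurableSet]
  -- The indicator of the ball is radial, so it joins the Bessel factors and the angular integral
  -- vanishes separately.
  have key := integral_radial_mul_angular
    (fun r => if r < R then ((sphericalBessel n' (k * r) * sphericalBessel n (k * r) : ℝ) : ℂ)
      else 0)
    (fun x => sphericalHarmonic n' m' x * (starRingEnd ℂ) (sphericalHarmonic n m x))
  rw [sphericalHarmonic_orthogonal_of_degree_ne m m' h, mul_zero] at key
  rw [← key]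
  refine integral_congr_ae (Filter.Eventually.of_forall fun x => ?_)
  simp only [Set.indicator, mem_ball_zero_iff, sphericalWave, map_mul, Complex.conj_ofReal]
  split_ifs
  · push_cast
    ring
  · rw [zero_mul]

/-! ### Herglotz waves and Fourier coefficients on `S(0,k)` -/

theorem measurableEmbedding_smul_sphere {k : ℝ} (hk : k ≠ 0) :
    MeasurableEmbedding (fun ω : Metric.sphere (0 : E3) 1 => k • (ω : E3)) :=
  (Homeomorph.smulOfNeZero k hk).measurableEmbedding.comp
    (MeasurableEmbedding.subtype_coe Metric.isClosed_sphere.measurableSet)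

theorem integral_surf {k : ℝ} (hk : k ≠ 0) (F : E3 → ℂ) :
    ∫ z, F z ∂(surf k) = (k : ℂ) ^ 2 * ∫ ω, F (k • (ω : E3)) ∂sphereMeasure := by
  rw [surf, integral_smul_measure, (measurableEmbedding_smul_sphere hk).integral_map,
    ENNReal.toReal_ofReal (sq_nonneg k), Complex.real_smul, Complex.ofReal_pow]

theorem integrable_surf_of_continuous {k : ℝ} (hk : k ≠ 0) {F : E3 → ℂ} (hF : Continuous F) :
    Integrable F (surf k) := by
  refine Integrable.smul_measure ?_ ENNReal.ofReal_ne_top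
  rw [(measurableEmbedding_smul_sphere hk).integrable_map_iff]
  exact integrable_of_continuous (F := fun x => F (k • x)) (by fun_prop)

theorem memLp_surf_of_continuous {k : ℝ} (hk : k ≠ 0) {F : E3 → ℂ} (hF : Continuous F) :
    MemLp F 2 (surf k) := by
  refine MemLp.smul_measure ?_ ENNReal.ofReal_ne_top
  rw [(measurableEmbedding_smul_sphere hk).memLp_map_measure_iff]
  exact Continuous.memLp_of_hasCompactSupport (by fun_prop) (HasCompactSupport.of_compactSpace _)

/-- The Herglotz wave function with density `Y_{nm}(·/k)` is a multiple of `u_{nm}`. -/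
theorem integral_surf_sphericalHarmonic {k : ℝ} (hk : 0 < k) {n : ℕ} {m : ℤ} (hm : m.natAbs ≤ n)
    (x : E3) :
    ∫ z, sphericalHarmonic n m (k⁻¹ • z) * Complex.exp (Complex.I * (inner ℝ x z : ℝ))
      ∂(surf k) = 4 * Real.pi * (k : ℂ) ^ 2 * Complex.I ^ n * sphericalWave k n m x := by
  rw [integral_surf hk.ne']
  have h := funkHecke hm (k • x)
  have hn : ‖k • x‖ = k * ‖x‖ := by rw [norm_smul, Real.norm_of_nonneg hk.le]
  have hu : ‖k • x‖⁻¹ • (k • x) = ‖x‖⁻¹ • x := by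
    rw [hn, smul_smul, mul_inv, mul_right_comm, inv_mul_cancel₀ hk.ne', one_mul]
  rw [hu, hn] at h
  simp only [inv_smul_smul₀ hk.ne', inner_smul_right]
  simp only [inner_smul_left, conj_trivial] at h
  rw [h, sphericalWave]
  ring

theorem integrable_of_memLp_top_of_support {f : E3 → ℂ} {R : ℝ} (hf : MemLp f ⊤ volume)
    (hsupp : ∀ᵐ x : E3, x ∉ Metric.ball (0 : E3) R → f x = 0) : Integrable f := by
  have hfin : IsFiniteMeasure (volume.restrict (Metric.ball (0 : E3) R)) :=
    ⟨by rw [Measure.restrict_apply_univ]; exact measure_ball_lt_top⟩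
  have h1 : IntegrableOn f (Metric.ball (0 : E3) R) := (memLp_two_ball hf R).integrable one_le_two
  refine (integrable_indicator_iff Metric.isOpen_ball.measurableSet).2 h1 |>.congr ?_
  filter_upwards [hsupp] with x hx
  by_cases h : x ∈ Metric.ball (0 : E3) R
  · rw [Set.indicator_of_mem h]
  · rw [Set.indicator_of_notMem h, hx h]

/-- The coefficient of the Fourier transform on the sphere is a multiple of `⟨u_{nm}, f⟩`. -/
theorem sphereCoeff_eq {k R : ℝ} (hk : 0 < k) {n : ℕ} {m : ℤ} (hm : m.natAbs ≤ n) {f : E3 → ℂ}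
    (hf : MemLp f ⊤ volume) (hsupp : ∀ᵐ x : E3, x ∉ Metric.ball (0 : E3) R → f x = 0) :
    sphereCoeff k n m f = 4 * Real.pi * (k : ℂ) ^ 2 * (starRingEnd ℂ) (Complex.I ^ n) *
      inner ℂ (waveL2 k R n m) (restrictL2 R f hf) := by
  have hY := continuous_sphericalHarmonic n m
  have hfi := integrable_of_memLp_top_of_support hf hsupp
  have hfin : SFinite (surf k) := by
    unfold surf
    infer_instance
  rw [restrictL2, inner_waveL2_toLp, setIntegral_eq_integral_of_ae_compl_eq_zero (by
    filter_upwards [hsupp] with x hx h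
    rw [hx h, zero_mul]), sphereCoeff]
  have h1 : ∀ z : E3, (starRingEnd ℂ) (sphericalHarmonic n m (k⁻¹ • z)) * fhat f z =
      ∫ x, f x * (starRingEnd ℂ) (sphericalHarmonic n m (k⁻¹ • z) *
        Complex.exp (Complex.I * (inner ℝ x z : ℝ))) := fun z => by
    rw [fhat, ← integral_const_mul]
    refine integral_congr_ae (Filter.Eventually.of_forall fun x => ?_)
    simp only [map_mul, ← Complex.exp_conj, Complex.conj_I, Complex.conj_ofReal, neg_mul]
    ring
  simp only [h1]
  rw [integral_integral_swap]
  · simp only [integral_const_mul, integral_conj, integral_surf_sphericalHarmonic hk hm]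
    rw [← integral_const_mul]
    refine integral_congr_ae (Filter.Eventually.of_forall fun x => ?_)
    simp only [map_mul, map_pow, Complex.conj_ofReal, map_ofNat]
    ring
  · have hYi : Integrable (fun z : E3 => (starRingEnd ℂ) (sphericalHarmonic n m (k⁻¹ • z)))
        (surf k) := integrable_surf_of_continuous hk.ne' (Complex.continuous_conj.comp (by fun_prop))
    have hE : Continuous fun p : E3 × E3 =>
        (starRingEnd ℂ) (Complex.exp (Complex.I * (inner ℝ p.2 p.1 : ℝ))) :=
      Complex.continuous_conj.comp (by fun_prop)
    -- Fubini applies because the plane wave has modulus one and the rest is a product of integrable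
    -- functions.
    refine ((hYi.mul_prod hfi).bdd_mul (c := 1) hE.aestronglyMeasurable
      (Filter.Eventually.of_forall fun p => ?_)).congr (Filter.Eventually.of_forall fun p => ?_)
    · rw [RCLike.norm_conj, mul_comm, Complex.norm_exp_ofReal_mul_I]
    · simp only [Function.uncurry, map_mul]
      ring

theorem continuous_density (k R : ℝ) (N : ℕ) (f : E3 → ℂ) : Continuous (density k R N f) := by
  unfold density
  have := continuous_sphericalHarmonic
  fun_prop

/-- The Herglotz wave function with density `g_{R,N}` is the orthogonal expansion of `f`. -/
theorem herglotz_density {k R : ℝ} (hk : 0 < k) (N : ℕ) {f : E3 → ℂ} (hf : MemLp f ⊤ volume)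
    (hsupp : ∀ᵐ x : E3, x ∉ Metric.ball (0 : E3) R → f x = 0) (x : E3) :
    herglotz k (density k R N f) x =
      ∑ n ∈ Finset.range (N + 1), ∑ m ∈ Finset.Icc (-(n : ℤ)) n,
        inner ℂ (waveL2 k R n m) (restrictL2 R f hf) /
          inner ℂ (waveL2 k R n m) (waveL2 k R n m) * sphericalWave k n m x := by
  have hint : ∀ n m, Integrable (fun z => 1 / (4 * (Real.pi : ℂ) * (k : ℂ) ^ 2) ^ 2 *
      (sphereCoeff k n m f / inner ℂ (waveL2 k R n m) (waveL2 k R n m)) *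
        (sphericalHarmonic n m (k⁻¹ • z) * Complex.exp (Complex.I * (inner ℝ x z : ℝ))))
      (surf k) := fun n m => by
    have := continuous_sphericalHarmonic n m
    exact integrable_surf_of_continuous hk.ne' (by fun_prop)
  have h1 : ∀ z, density k R N f z * Complex.exp (Complex.I * (inner ℝ x z : ℝ)) =
      ∑ n ∈ Finset.range (N + 1), ∑ m ∈ Finset.Icc (-(n : ℤ)) n,
        1 / (4 * (Real.pi : ℂ) * (k : ℂ) ^ 2) ^ 2 *
        (sphereCoeff k n m f / inner ℂ (waveL2 k R n m) (waveL2 k R n m)) *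
        (sphericalHarmonic n m (k⁻¹ • z) * Complex.exp (Complex.I * (inner ℝ x z : ℝ))) :=
    fun z => by
      simp only [density, Finset.mul_sum, Finset.sum_mul]
      exact Finset.sum_congr rfl fun n _ => Finset.sum_congr rfl fun m _ => by ring
  simp only [herglotz, h1]
  rw [integral_finsetSum _ fun n _ => integrable_finsetSum _ fun m _ => hint n m]
  refine Finset.sum_congr rfl fun n _ => ?_
  rw [integral_finsetSum _ fun m _ => hint n m]
  refine Finset.sum_congr rfl fun m hm => ?_
  have hm' : m.natAbs ≤ n := by
    rw [Finset.mem_Icc] at hm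
    omega
  rw [integral_const_mul, integral_surf_sphericalHarmonic hk hm', sphereCoeff_eq hk hm' hf hsupp]
  have hI : (starRingEnd ℂ) (Complex.I ^ n) * Complex.I ^ n = 1 := by
    rw [map_pow, ← mul_pow, Complex.conj_I, neg_mul, Complex.I_mul_I, neg_neg, one_pow]
  have hpi : (Real.pi : ℂ) ≠ 0 := by exact_mod_cast Real.pi_ne_zero
  have hk0 : (k : ℂ) ≠ 0 := by exact_mod_cast hk.ne'
  set D : ℂ := 4 * (Real.pi : ℂ) * (k : ℂ) ^ 2 with hD
  have hD0 : D ≠ 0 := mul_ne_zero (mul_ne_zero (by norm_num) hpi) (pow_ne_zero _ hk0)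
  have hDD : 1 / D ^ 2 * (D * D) = 1 := by
    field_simp
  set A := inner ℂ (waveL2 k R n m) (restrictL2 R f hf)
  set B := inner ℂ (waveL2 k R n m) (waveL2 k R n m)
  calc _ = (1 / D ^ 2 * (D * D)) * ((starRingEnd ℂ) (Complex.I ^ n) * Complex.I ^ n) *
        (A / B * sphericalWave k n m x) := by ring
    _ = _ := by rw [hDD, hI, one_mul, one_mul]

/-! ### The orthogonal projection and the conclusion -/

theorem inner_waveL2_of_ne (k R : ℝ) {n n' : ℕ} {m m' : ℤ} (h : ¬ (n = n' ∧ m = m')) :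
    inner ℂ (waveL2 k R n m) (waveL2 k R n' m') = 0 := by
  by_cases hm : m = m'
  · exact inner_waveL2_of_degree_ne k R m m' fun hn => h ⟨hn, hm⟩
  · exact inner_waveL2_of_order_ne k R n n' hm

theorem waveL2_mem_waveSpace (k R : ℝ) {N n : ℕ} {m : ℤ} (hn : n ∈ Finset.range (N + 1))
    (hm : m ∈ Finset.Icc (-(n : ℤ)) n) : waveL2 k R n m ∈ waveSpace k R N :=
  Submodule.subset_span (Set.mem_biUnion hn (Set.mem_biUnion hm rfl))

/-- The orthogonal projection onto the span of the spherical waves is the orthogonal expansion. -/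
theorem bestApprox_eq_sum (k R : ℝ) (N : ℕ) (f : E3 → ℂ) (hf : MemLp f ⊤ volume) :
    bestApprox k R N f hf = ∑ n ∈ Finset.range (N + 1), ∑ m ∈ Finset.Icc (-(n : ℤ)) n,
      (inner ℂ (waveL2 k R n m) (restrictL2 R f hf) /
        inner ℂ (waveL2 k R n m) (waveL2 k R n m)) • waveL2 k R n m := by
  refine Submodule.eq_starProjection_of_mem_orthogonal ?_ ?_
  · exact Submodule.sum_mem _ fun n hn => Submodule.sum_mem _ fun m hm =>
      Submodule.smul_mem _ _ (waveL2_mem_waveSpace k R hn hm)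
  · rw [waveSpace, Submodule.mem_orthogonal]
    intro u hu
    induction hu using Submodule.span_induction with
    | zero => exact inner_zero_left _
    | add u v _ _ hu hv => rw [inner_add_left, hu, hv, add_zero]
    | smul c u _ hu => rw [inner_smul_left, hu, mul_zero]
    | mem u hu =>
      simp only [Set.mem_iUnion, Set.mem_singleton_iff] at hu
      obtain ⟨n, hn, m, hm, rfl⟩ := hu
      simp only [inner_sub_right, inner_sum, inner_smul_right]
      rw [Finset.sum_eq_single_of_mem n hn, Finset.sum_eq_single_of_mem m hm]
      -- Were `u_{nm}` zero in `L²`, the quotient would be `0` by convention and both terms would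
      -- vanish, so nonvanishing norms need not be proved.
      · by_cases h0 : inner ℂ (waveL2 k R n m) (waveL2 k R n m) = 0
        · rw [inner_self_eq_zero.1 h0, inner_zero_left, inner_zero_left, mul_zero, sub_zero]
        · rw [div_mul_cancel₀ _ h0, sub_self]
      · intro m' _ hne
        rw [inner_waveL2_of_ne k R fun h => hne h.2.symm, mul_zero]
      · intro n' _ hne
        refine Finset.sum_eq_zero fun m' _ => ?_
        rw [inner_waveL2_of_ne k R fun h => hne h.1.symm, mul_zero]

theorem coeFn_sum_waveL2 (k R : ℝ) (N : ℕ) (c : ℕ → ℤ → ℂ) :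
    ((∑ n ∈ Finset.range (N + 1), ∑ m ∈ Finset.Icc (-(n : ℤ)) n, c n m • waveL2 k R n m :
        L2Ball R) : E3 → ℂ) =ᵐ[volume.restrict (Metric.ball (0 : E3) R)]
      fun x => ∑ n ∈ Finset.range (N + 1), ∑ m ∈ Finset.Icc (-(n : ℤ)) n,
        c n m * sphericalWave k n m x := by
  have h1 : ∀ᵐ x ∂(volume.restrict (Metric.ball (0 : E3) R)), ∀ (n : ℕ) (m : ℤ),
      (c n m • waveL2 k R n m : L2Ball R) x = c n m * sphericalWave k n m x := by
    refine ae_all_iff.2 fun n => ae_all_iff.2 fun m => ?_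
    filter_upwards [Lp.coeFn_smul (c n m) (waveL2 k R n m),
      (memLp_sphericalWave k R n m).coeFn_toLp] with x h1 h2
    rw [h1, Pi.smul_apply, smul_eq_mul, ← h2, waveL2]
  have h2 : ∀ᵐ x ∂(volume.restrict (Metric.ball (0 : E3) R)), ∀ n : ℕ,
      (∑ m ∈ Finset.Icc (-(n : ℤ)) n, c n m • waveL2 k R n m : L2Ball R) x =
        ∑ m ∈ Finset.Icc (-(n : ℤ)) n, (c n m • waveL2 k R n m : L2Ball R) x := by
    refine ae_all_iff.2 fun n => ?_
    filter_upwards [Lp.coeFn_finsetSum (Finset.Icc (-(n : ℤ)) n)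
      (fun m => c n m • waveL2 k R n m)] with x hx
    rw [hx, Finset.sum_apply]
  filter_upwards [h1, h2, Lp.coeFn_finsetSum (Finset.range (N + 1))
    (fun n => ∑ m ∈ Finset.Icc (-(n : ℤ)) n, c n m • waveL2 k R n m)] with x h1 h2 h3
  rw [h3, Finset.sum_apply]
  simp only [h2, h1]

end HerglotzBall

theorem mainTheorem7 (k R : ℝ) (hk : 0 < k) (hR : 0 < R) (N : ℕ)
    (f : HerglotzBall.E3 → ℂ) (hf : MemLp f ⊤ volume)
    (hsupp : ∀ᵐ x : HerglotzBall.E3, x ∉ Metric.ball (0 : HerglotzBall.E3) R → f x = 0) :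
    MemLp (HerglotzBall.density k R N f) 2 (HerglotzBall.surf k) ∧
    (HerglotzBall.bestApprox k R N f hf : HerglotzBall.E3 → ℂ)
      =ᵐ[volume.restrict (Metric.ball (0 : HerglotzBall.E3) R)]
        HerglotzBall.herglotz k (HerglotzBall.density k R N f) ∧
    ∀ x : HerglotzBall.E3,
      ∑ n ∈ Finset.range (N + 1), ∑ m ∈ Finset.Icc (-(n : ℤ)) n,
        inner ℂ (HerglotzBall.waveL2 k R n m) (HerglotzBall.restrictL2 R f hf) /
            inner ℂ (HerglotzBall.waveL2 k R n m) (HerglotzBall.waveL2 k R n m) *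
          HerglotzBall.sphericalWave k n m x =
        HerglotzBall.herglotz k (HerglotzBall.density k R N f) x := by
  refine ⟨HerglotzBall.memLp_surf_of_continuous hk.ne' (HerglotzBall.continuous_density k R N f),
    ?_, fun x => (HerglotzBall.herglotz_density hk N hf hsupp x).symm⟩
  rw [HerglotzBall.bestApprox_eq_sum]
  refine (HerglotzBall.coeFn_sum_waveL2 k R N _).trans (Filter.Eventually.of_forall fun x => ?_)
  exact (HerglotzBall.herglotz_density hk N hf hsupp x).symm
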